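/- Let $X$ be a real or complex Banach space that is uniformly convex and smooth, where smooth means that for every $x\in X$ with $\|x\|=1$ there is exactly one bounded linear functional $f$ on $X$ with $\|f\|=1$ and $f(x)=1$. Let $P_1,P_2\colon X\to X$ be two norm-one projections, that is, bounded linear operators with $P_i^2=P_i$ and $\|P_i\|=1$. Then $P_1$ and $P_2$ are consistent: there is a bounded linear projection $P_{12}\colon X\to X$ onto $\operatorname{im}P_1\cap\operatorname{im}P_2$ (that is, $P_{12}^2=P_{12}$ and $\operatorname{im}P_{12}=\operatorname{im}P_1\cap\operatorname{im}P_2$) with $P_{12}P_1=P_{12}P_2=P_{12}$. Moreover, $P_{12}$ can be chosen to be the common strong limit of the iterates: for every $x\in X$, $$P_{12}x=\lim_{n\to\infty}(P_1P_2)^n x=\lim_{n\to\infty}(P_2P_1)^n x .$$ -/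

import Mathlib

/-- A normed space over `𝕜 = ℝ` or `ℂ` is *smooth* if every point of its unit sphere has exactly
one support functional, i.e. exactly one norm-one bounded linear functional taking the value `1`
at that point. -/
def IsSmoothSpace (𝕜 X : Type*) [RCLike 𝕜] [NormedAddCommGroup X] [NormedSpace 𝕜 X] : Prop :=
  ∀ x : X, ‖x‖ = 1 → ∃! f : StrongDual 𝕜 X, ‖f‖ = 1 ∧ f x = 1

/-- `P` is a norm-one projection: a bounded linear idempotent of operator norm one. -/
structure IsNormOneProjection {𝕜 X : Type*} [RCLike 𝕜] [NormedAddCommGroup X] [NormedSpace 𝕜 X]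
    (P : X →L[𝕜] X) : Prop where
  idem : P ∘L P = P
  norm_eq_one : ‖P‖ = 1

/-- `P₁₂` is a *consistency projection* for `P₁` and `P₂`: a bounded linear projection onto (all of)
`im P₁ ∩ im P₂` with `P₁₂ P₁ = P₁₂` and `P₁₂ P₂ = P₁₂`. The projections `P₁` and `P₂` are
*consistent* if one exists. -/
structure IsConsistencyProjection {𝕜 X : Type*} [RCLike 𝕜] [NormedAddCommGroup X]
    [NormedSpace 𝕜 X] (P₁ P₂ P₁₂ : X →L[𝕜] X) : Prop where
  idem : P₁₂ ∘L P₁₂ = P₁₂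
  range_eq : Set.range P₁₂ = Set.range P₁ ∩ Set.range P₂
  comp_left : P₁₂ ∘L P₁ = P₁₂
  comp_right : P₁₂ ∘L P₂ = P₁₂

open Filter Topology

/-! For T = P₁P₂ the norms ‖Tⁿx‖ decrease, so asymptotically neither projection loses norm. By
uniform convexity each then moves its argument by o(1) (`tendsto_sub_apply`), whence Tⁿ(x - Tx) → 0.
The splitting of x into a fixed vector plus a limit of vectors y - Ty turns this into strong
convergence of Tⁿ. The limits R of (P₁P₂)ⁿ and S of (P₂P₁)ⁿ are contractive projections onto the
same intersection. Smoothness makes them equal: the support functional at Rx - Sx is invariant under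
both, hence vanishes there. -/

section UniformConvex

variable {E : Type*} [NormedAddCommGroup E] [NormedSpace ℝ E] [UniformConvexSpace E]

/-- In a uniformly convex space, two points of norm at most about `r` whose midpoint has norm at
least `r` are close to each other. -/
theorem UniformConvexSpace.exists_forall_norm_sub_lt {r ε : ℝ} (hr : 0 ≤ r) (hε : 0 < ε) :
    ∃ η > 0, ∀ u v : E, ‖u‖ ≤ r + η → ‖v‖ ≤ r + η → 2 * r ≤ ‖u + v‖ → ‖u - v‖ < ε := by
  rcases hr.eq_or_lt with rfl | hr
  · refine ⟨ε / 3, by positivity, fun u v hu hv _ => ?_⟩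
    linarith [norm_sub_le u v]
  · obtain ⟨δ, hδ, h⟩ := exists_forall_closed_ball_dist_add_le_two_sub E
      (show 0 < ε / (r + 1) by positivity)
    -- The cap 1 gives ε/(r+1) ≤ ε/s; the bound δr/4 gives (2-δ)s < 2r.
    have hη : 0 < min 1 (δ * r / 4) := by positivity
    refine ⟨min 1 (δ * r / 4), hη, fun u v hu hv huv => ?_⟩
    set s := r + min 1 (δ * r / 4) with hs
    have h1 : s ≤ r + 1 := by linarith [min_le_left 1 (δ * r / 4)]
    have h2 : s ≤ r + δ * r / 4 := by linarith [min_le_right 1 (δ * r / 4)]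
    have hs0 : 0 < s := by positivity
    have key : ∀ w : E, ‖s⁻¹ • w‖ = ‖w‖ / s := fun w => by
      rw [norm_smul, norm_inv, Real.norm_of_nonneg hs0.le, inv_mul_eq_div]
    by_contra! hlt
    have := h (x := s⁻¹ • u) (by rw [key]; exact (div_le_one hs0).2 hu)
      (y := s⁻¹ • v) (by rw [key]; exact (div_le_one hs0).2 hv)
      (by rw [← smul_sub, key]; gcongr)
    rw [← smul_add, key, div_le_iff₀ hs0] at this
    have h3 : δ * r ≤ δ * s := by gcongr; linarith
    nlinarith [mul_pos hδ hr]

/-- A nonempty closed set that contains all midpoints of its points has an element of least norm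
in a complete uniformly convex space. -/
theorem IsClosed.exists_forall_norm_le_of_midpoint [CompleteSpace E] {C : Set E}
    (hC : IsClosed C) (hne : C.Nonempty)
    (hmid : ∀ x ∈ C, ∀ y ∈ C, (2⁻¹ : ℝ) • (x + y) ∈ C) :
    ∃ z ∈ C, ∀ y ∈ C, ‖z‖ ≤ ‖y‖ := by
  set d := sInf (norm '' C) with hd
  have hbdd : BddBelow (norm '' C) := ⟨0, by rintro _ ⟨x, -, rfl⟩; exact norm_nonneg x⟩
  have hle : ∀ y ∈ C, d ≤ ‖y‖ := fun y hy => csInf_le hbdd ⟨y, hy, rfl⟩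
  have hd0 : 0 ≤ d := le_csInf (hne.image _) (by rintro _ ⟨x, -, rfl⟩; exact norm_nonneg x)
  obtain ⟨a, -, ha, haC⟩ := exists_seq_tendsto_sInf (hne.image norm) hbdd
  choose u huC hu using haC
  obtain rfl : a = fun n => ‖u n‖ := funext fun n => (hu n).symm
  have hcau : CauchySeq u := by
    refine Metric.cauchySeq_iff.2 fun ε hε => ?_
    obtain ⟨η, hη, h⟩ := UniformConvexSpace.exists_forall_norm_sub_lt (E := E) hd0 hε
    obtain ⟨N, hN⟩ := eventually_atTop.1
      (ha.eventually_le_const (show d < d + η by linarith))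
    refine ⟨N, fun m hm n hn => ?_⟩
    rw [dist_eq_norm]
    refine h _ _ (hN m hm) (hN n hn) ?_
    have := hle _ (hmid _ (huC m) _ (huC n))
    rw [norm_smul, norm_inv, Real.norm_ofNat] at this
    linarith
  obtain ⟨z, hz⟩ := cauchySeq_tendsto_of_complete hcau
  refine ⟨z, hC.mem_of_tendsto hz (Eventually.of_forall huC), fun y hy => ?_⟩
  exact (tendsto_nhds_unique hz.norm ha).trans_le (hle y hy)

end UniformConvex

section Contraction

variable {𝕜 X : Type*} [RCLike 𝕜] [NormedAddCommGroup X] [NormedSpace 𝕜 X]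

theorem ContinuousLinearMap.norm_apply_le_of_norm_le_one {T : X →L[𝕜] X} (hT : ‖T‖ ≤ 1) (x : X) :
    ‖T x‖ ≤ ‖x‖ := by
  simpa using T.le_of_opNorm_le hT x

variable [UniformConvexSpace X]

/-- A contraction of a complete uniformly convex space splits every vector into a fixed vector and
a limit of vectors of the form `y - T y`. -/
theorem ContinuousLinearMap.exists_fixed_sub_mem_closure_range [CompleteSpace X] {T : X →L[𝕜] X}
    (hT : ‖T‖ ≤ 1) (x : X) :
    ∃ z, T z = z ∧ x - z ∈ closure (Set.range fun y => y - T y) := by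
  let _ : NormedSpace ℝ X := NormedSpace.restrictScalars ℝ 𝕜 X
  let D : Submodule 𝕜 X :=
    (LinearMap.range ((1 : X →L[𝕜] X) - T : X →L[𝕜] X).toLinearMap).topologicalClosure
  have hD : (D : Set X) = closure (Set.range fun y => y - T y) := rfl
  have hDT : ∀ y, y - T y ∈ D := fun y => Submodule.le_topologicalClosure _ ⟨y, rfl⟩
  let C : Set X := {z | x - z ∈ D}
  have hCc : IsClosed C :=
    (Submodule.isClosed_topologicalClosure _).preimage (continuous_const.sub continuous_id)
  have hmid : ∀ y ∈ C, ∀ z ∈ C, (2⁻¹ : ℝ) • (y + z) ∈ C := by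
    intro y hy z hz
    have h : x - (2⁻¹ : ℝ) • (y + z) = ((2⁻¹ : ℝ) : 𝕜) • ((x - y) + (x - z)) := by
      change _ = (2⁻¹ : ℝ) • ((x - y) + (x - z))
      module
    change _ ∈ D
    rw [h]
    exact D.smul_mem _ (D.add_mem hy hz)
  obtain ⟨z, hz, hmin⟩ := hCc.exists_forall_norm_le_of_midpoint
    ⟨x, show x - x ∈ D by simp⟩ hmid
  refine ⟨z, ?_, hD ▸ hz⟩
  have hTz : T z ∈ C := by
    have : x - T z = (x - z) + (z - T z) := by abel
    change _ ∈ D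
    rw [this]
    exact D.add_mem hz (hDT z)
  -- `T z` and `z` lie in `C` with norm at most the minimum ‖z‖, and so does their midpoint in `C`;
  -- with ε = ‖Tz - z‖ uniform convexity yields ε < ε.
  by_contra hne
  obtain ⟨η, hη, h⟩ := UniformConvexSpace.exists_forall_norm_sub_lt (E := X) (norm_nonneg z)
    (norm_pos_iff.2 (sub_ne_zero.2 hne))
  refine (h (T z) z ?_ (by linarith) ?_).false
  · linarith [norm_apply_le_of_norm_le_one hT z]
  · have := hmin _ (hmid _ hTz _ hz)
    rw [norm_smul, norm_inv, Real.norm_ofNat] at this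
    linarith

/-- The powers of an asymptotically regular contraction of a complete uniformly convex space
converge pointwise to fixed points. -/
theorem ContinuousLinearMap.exists_fixed_tendsto_pow [CompleteSpace X] {T : X →L[𝕜] X}
    (hT : ‖T‖ ≤ 1) (hreg : ∀ x, Tendsto (fun n : ℕ => (T ^ n) (x - T x)) atTop (𝓝 0)) (x : X) :
    ∃ z, T z = z ∧ Tendsto (fun n : ℕ => (T ^ n) x) atTop (𝓝 z) := by
  obtain ⟨z, hz, hxz⟩ := exists_fixed_sub_mem_closure_range hT x
  have hpow : ∀ n : ℕ, ‖T ^ n‖ ≤ 1 := fun n => by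
    induction n with
    | zero => exact ContinuousLinearMap.norm_id_le
    | succ n ih =>
      rw [pow_succ]
      exact (norm_mul_le _ _).trans (mul_le_one₀ ih (norm_nonneg _) hT)
  have hfix : ∀ n : ℕ, (T ^ n) z = z := fun n => by
    induction n with
    | zero => simp
    | succ n ih => rw [pow_succ, mul_apply_eq_comp, hz, ih]
  refine ⟨z, hz, ?_⟩
  rw [Metric.tendsto_atTop]
  intro ε hε
  obtain ⟨_, ⟨y, rfl⟩, hy⟩ := Metric.mem_closure_iff.1 hxz (ε / 2) (by positivity)
  obtain ⟨N, hN⟩ := Metric.tendsto_atTop.1 (hreg y) (ε / 2) (by positivity)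
  refine ⟨N, fun n hn => ?_⟩
  have h1 := hN n hn
  have h2 := norm_apply_le_of_norm_le_one (hpow n) (x - z - (y - T y))
  rw [dist_zero_right] at h1
  rw [dist_eq_norm] at hy ⊢
  have h3 : (T ^ n) x - z = (T ^ n) (x - z - (y - T y)) + (T ^ n) (y - T y) := by
    rw [← map_add, sub_add_cancel, map_sub, hfix]
  rw [h3]
  linarith [norm_add_le ((T ^ n) (x - z - (y - T y))) ((T ^ n) (y - T y))]

end Contraction

namespace IsNormOneProjection

variable {𝕜 X : Type*} [RCLike 𝕜] [NormedAddCommGroup X] [NormedSpace 𝕜 X] {P Q : X →L[𝕜] X}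

theorem apply_apply (hP : IsNormOneProjection P) (x : X) : P (P x) = P x :=
  DFunLike.congr_fun hP.idem x

theorem mem_range_iff (hP : IsNormOneProjection P) {x : X} : x ∈ Set.range P ↔ P x = x :=
  ⟨by rintro ⟨y, rfl⟩; exact hP.apply_apply y, fun h => ⟨x, h⟩⟩

theorem norm_apply_le (hP : IsNormOneProjection P) (x : X) : ‖P x‖ ≤ ‖x‖ :=
  ContinuousLinearMap.norm_apply_le_of_norm_le_one hP.norm_eq_one.le x

/-- Supplies the midpoint bound needed to apply uniform convexity to the pair x, Px. -/
theorem two_mul_norm_apply_le (hP : IsNormOneProjection P) (x : X) : 2 * ‖P x‖ ≤ ‖x + P x‖ := by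
  have h : P (x + P x) = (2 : 𝕜) • P x := by rw [map_add, hP.apply_apply, two_smul]
  have := hP.norm_apply_le (x + P x)
  rwa [h, norm_smul, RCLike.norm_ofNat] at this

theorem norm_mul_le_one (hP : IsNormOneProjection P) (hQ : IsNormOneProjection Q) :
    ‖P * Q‖ ≤ 1 := by
  simpa [hP.norm_eq_one, hQ.norm_eq_one] using norm_mul_le P Q

variable [UniformConvexSpace X]

/-- If a norm-one projection asymptotically preserves the norms of a sequence, it asymptotically
fixes the sequence. -/
theorem tendsto_sub_apply (hP : IsNormOneProjection P) {u : ℕ → X} {r : ℝ}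
    (hu : Tendsto (fun n => ‖u n‖) atTop (𝓝 r)) (hle : ∀ n, r ≤ ‖P (u n)‖) :
    Tendsto (fun n => u n - P (u n)) atTop (𝓝 0) := by
  let _ : NormedSpace ℝ X := NormedSpace.restrictScalars ℝ 𝕜 X
  have hr : 0 ≤ r := ge_of_tendsto' hu fun n => norm_nonneg _
  refine Metric.tendsto_atTop.2 fun ε hε => ?_
  obtain ⟨η, hη, h⟩ := UniformConvexSpace.exists_forall_norm_sub_lt (E := X) hr hε
  obtain ⟨N, hN⟩ := eventually_atTop.1 (hu.eventually_le_const (show r < r + η by linarith))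
  refine ⟨N, fun n hn => ?_⟩
  rw [dist_zero_right]
  exact h _ _ (hN n hn) ((hP.norm_apply_le _).trans (hN n hn))
    (by linarith [hle n, hP.two_mul_norm_apply_le (u n)])

theorem apply_eq_self_of_norm_le (hP : IsNormOneProjection P) {x : X} (h : ‖x‖ ≤ ‖P x‖) :
    P x = x := by
  have := hP.tendsto_sub_apply (u := fun _ => x) tendsto_const_nhds fun _ => h
  exact (sub_eq_zero.1 (tendsto_nhds_unique tendsto_const_nhds this)).symm

theorem tendsto_mul_pow_sub (hP : IsNormOneProjection P) (hQ : IsNormOneProjection Q) (x : X) :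
    Tendsto (fun n : ℕ => ((P * Q) ^ n) (x - (P * Q) x)) atTop (𝓝 0) := by
  set u : ℕ → X := fun n => ((P * Q) ^ n) x with hu
  have hsucc : ∀ n, u (n + 1) = P (Q (u n)) := fun n => by
    simp only [hu, pow_succ', mul_apply_eq_comp]
  have hanti : Antitone fun n => ‖u n‖ := antitone_nat_of_succ_le fun n => by
    rw [hsucc]
    exact (hP.norm_apply_le _).trans (hQ.norm_apply_le _)
  have hbdd : BddBelow (Set.range fun n => ‖u n‖) :=
    ⟨0, by rintro _ ⟨n, rfl⟩; exact norm_nonneg _⟩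
  have hlim := tendsto_atTop_ciInf hanti hbdd
  have hPQ : ∀ n, ⨅ n, ‖u n‖ ≤ ‖P (Q (u n))‖ := fun n => by
    rw [← hsucc]
    exact ciInf_le hbdd (n + 1)
  have hQle : ∀ n, ⨅ n, ‖u n‖ ≤ ‖Q (u n)‖ := fun n => (hPQ n).trans (hP.norm_apply_le _)
  have hlimQ : Tendsto (fun n => ‖Q (u n)‖) atTop (𝓝 (⨅ n, ‖u n‖)) :=
    tendsto_of_tendsto_of_tendsto_of_le_of_le tendsto_const_nhds hlim hQle
      fun n => hQ.norm_apply_le _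
  -- The two differences telescope to uₙ - uₙ₊₁.
  have := (hQ.tendsto_sub_apply hlim hQle).add (hP.tendsto_sub_apply hlimQ hPQ)
  rw [add_zero] at this
  refine this.congr fun n => ?_
  rw [sub_add_sub_cancel, ← hsucc, map_sub, ← mul_apply_eq_comp, ← pow_succ]

theorem mul_apply_eq_self_iff (hP : IsNormOneProjection P) (hQ : IsNormOneProjection Q) {x : X} :
    (P * Q) x = x ↔ P x = x ∧ Q x = x := by
  refine ⟨fun h => ?_, fun h => by rw [mul_apply_eq_comp, h.2, h.1]⟩
  rw [mul_apply_eq_comp] at h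
  have hx : Q x = x := hQ.apply_eq_self_of_norm_le (by simpa [h] using hP.norm_apply_le (Q x))
  exact ⟨by rwa [hx] at h, hx⟩

/-- The iterates of the product of two norm-one projections converge strongly to a contraction
that maps into, and fixes, the intersection of the ranges. -/
theorem exists_tendsto_mul_pow [CompleteSpace X] (hP : IsNormOneProjection P)
    (hQ : IsNormOneProjection Q) :
    ∃ R : X →L[𝕜] X, ‖R‖ ≤ 1 ∧ (∀ x, P (R x) = R x ∧ Q (R x) = R x) ∧
      (∀ x, P x = x → Q x = x → R x = x) ∧
      ∀ x, Tendsto (fun n : ℕ => ((P * Q) ^ n) x) atTop (𝓝 (R x)) := by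
  have hT := hP.norm_mul_le_one hQ
  choose R hfix hR using ContinuousLinearMap.exists_fixed_tendsto_pow hT
    (hP.tendsto_mul_pow_sub hQ)
  have hpow : ∀ (n : ℕ) (x : X), ‖((P * Q) ^ n) x‖ ≤ ‖x‖ := fun n => by
    induction n with
    | zero => simp
    | succ n ih =>
      intro x
      rw [pow_succ, mul_apply_eq_comp]
      exact (ih _).trans (ContinuousLinearMap.norm_apply_le_of_norm_le_one hT x)
  let L : X →ₗ[𝕜] X :=
    { toFun := R
      map_add' := fun x y => tendsto_nhds_unique (hR (x + y)) <| by
        simpa only [map_add] using (hR x).add (hR y)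
      map_smul' := fun c x => tendsto_nhds_unique (hR (c • x)) <| by
        simpa only [map_smul, RingHom.id_apply] using (hR x).const_smul c }
  have hL : ∀ x, ‖L x‖ ≤ 1 * ‖x‖ := fun x => by
    rw [one_mul]
    exact le_of_tendsto' (hR x).norm fun n => hpow n x
  refine ⟨L.mkContinuous 1 hL, L.mkContinuous_norm_le zero_le_one hL,
    fun x => (hP.mul_apply_eq_self_iff hQ).1 (hfix x), fun x hPx hQx => ?_, hR⟩
  have hx : ∀ n : ℕ, ((P * Q) ^ n) x = x := fun n => by
    induction n with
    | zero => simp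
    | succ n ih =>
      rw [pow_succ, mul_apply_eq_comp,
        (hP.mul_apply_eq_self_iff hQ).2 ⟨hPx, hQx⟩, ih]
  exact tendsto_nhds_unique (hR x) (by simp only [hx]; exact tendsto_const_nhds)

end IsNormOneProjection

/-- In a smooth space, two contractive operators which fix each other's ranges agree. -/
theorem IsSmoothSpace.eq_of_norm_le_one {𝕜 X : Type*} [RCLike 𝕜] [NormedAddCommGroup X]
    [NormedSpace 𝕜 X] (hX : IsSmoothSpace 𝕜 X) {R S : X →L[𝕜] X} (hR : ‖R‖ ≤ 1) (hS : ‖S‖ ≤ 1)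
    (hfixR : ∀ x, R (R x - S x) = R x - S x) (hfixS : ∀ x, S (R x - S x) = R x - S x) :
    R = S := by
  ext x
  by_contra hne
  set w := R x - S x with hw
  have hw0 : w ≠ 0 := sub_ne_zero.2 hne
  set y : X := ((‖w‖ : 𝕜)⁻¹) • w with hy
  have hy1 : ‖y‖ = 1 := norm_smul_inv_norm hw0
  obtain ⟨f, ⟨hf, hfy⟩, huniq⟩ := hX y hy1
  -- `f ∘L T` is again a support functional at `y`, so uniqueness applies.
  have key : ∀ T : X →L[𝕜] X, ‖T‖ ≤ 1 → T w = w → f ∘L T = f := fun T hT hTw => by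
    have hval : (f ∘L T) y = 1 := by
      rw [ContinuousLinearMap.comp_apply, hy, map_smul, hTw, ← hy, hfy]
    refine huniq _ ⟨le_antisymm ?_ ?_, hval⟩
    · refine (f.opNorm_comp_le T).trans ?_
      rwa [hf, one_mul]
    · simpa [hval, hy1] using (f ∘L T).le_opNorm y
  have hfw : f w = 0 := by
    rw [hw, map_sub, sub_eq_zero]
    exact (DFunLike.congr_fun (key R hR (hfixR x)) x).trans
      (DFunLike.congr_fun (key S hS (hfixS x)) x).symm
  rw [hy, map_smul, hfw, smul_zero] at hfy
  exact zero_ne_one hfy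

theorem ContinuousLinearMap.apply_right_eq_of_tendsto_mul_pow {𝕜 X : Type*} [RCLike 𝕜]
    [NormedAddCommGroup X] [NormedSpace 𝕜 X] {P Q R : X →L[𝕜] X} (hQ : Q ∘L Q = Q)
    (hR : ∀ x, Tendsto (fun n : ℕ => ((P * Q) ^ n) x) atTop (𝓝 (R x))) : R ∘L Q = R := by
  ext x
  -- The shift to n + 1 ensures a rightmost factor Q, which absorbs the extra Q.
  refine tendsto_nhds_unique ((tendsto_add_atTop_iff_nat 1).2 (hR (Q x))) ?_
  refine ((tendsto_add_atTop_iff_nat 1).2 (hR x)).congr fun n => ?_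
  have hx : Q (Q x) = Q x := DFunLike.congr_fun hQ x
  simp only [pow_succ, mul_apply_eq_comp, hx]

theorem mainTheorem4 {𝕜 X : Type*} [RCLike 𝕜] [NormedAddCommGroup X] [NormedSpace 𝕜 X]
    [CompleteSpace X] [UniformConvexSpace X] (hsmooth : IsSmoothSpace 𝕜 X)
    (P₁ P₂ : X →L[𝕜] X) (hP₁ : IsNormOneProjection P₁) (hP₂ : IsNormOneProjection P₂) :
    ∃ P₁₂ : X →L[𝕜] X, IsConsistencyProjection P₁ P₂ P₁₂ ∧
      (∀ x : X, Filter.Tendsto (fun n : ℕ => ((P₁ * P₂) ^ n) x) Filter.atTop (nhds (P₁₂ x))) ∧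
      (∀ x : X, Filter.Tendsto (fun n : ℕ => ((P₂ * P₁) ^ n) x) Filter.atTop (nhds (P₁₂ x))) := by
  obtain ⟨R, hRn, hR, hRfix, hRlim⟩ := hP₁.exists_tendsto_mul_pow hP₂
  obtain ⟨S, hSn, hS, hSfix, hSlim⟩ := hP₂.exists_tendsto_mul_pow hP₁
  have h₁ : ∀ x, P₁ (R x - S x) = R x - S x := fun x => by rw [map_sub, (hR x).1, (hS x).2]
  have h₂ : ∀ x, P₂ (R x - S x) = R x - S x := fun x => by rw [map_sub, (hR x).2, (hS x).1]
  obtain rfl : R = S := hsmooth.eq_of_norm_le_one hRn hSn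
    (fun x => hRfix _ (h₁ x) (h₂ x)) (fun x => hSfix _ (h₂ x) (h₁ x))
  refine ⟨R, ⟨?_, ?_, ?_, ?_⟩, hRlim, hSlim⟩
  · ext x
    exact hRfix _ (hR x).1 (hR x).2
  · ext x
    rw [Set.mem_inter_iff, hP₁.mem_range_iff, hP₂.mem_range_iff]
    exact ⟨by rintro ⟨y, rfl⟩; exact hR y, fun h => ⟨x, hRfix x h.1 h.2⟩⟩
  -- Each order of the product absorbs only its right factor, so both limits are needed.
  · exact ContinuousLinearMap.apply_right_eq_of_tendsto_mul_pow hP₁.idem hSlim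
  · exact ContinuousLinearMap.apply_right_eq_of_tendsto_mul_pow hP₂.idem hRlim
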